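/- Let $G$ be a countable discrete group, equipped with a proper left-invariant metric, and let $H$ be an infinite-dimensional separable complex Hilbert space. A map $f$ from $G$ to a metric space has vanishing variation if for every $r>0$ the function $y\mapsto \sup\{d(f(y),f(x)) : x\in G,\ d(y,x)\le r\}$ tends to $0$ at infinity. Let $\bar{\mathfrak c}^{\mathrm{red}}G$ be the reduced stable Higson compactification of $G$, i.e. the $C^*$-algebra of all bounded functions $f\colon G\to\mathcal B(H)$ of vanishing variation such that $f(x)-f(y)$ is compact for all $x,y\in G$, with $G$ acting by left translation, $(g\cdot f)(x)=f(g^{-1}x)$. A (unital) $C^*$-algebra $A$ with an action $\alpha$ of $G$ by $*$-automorphisms is called an amenable $G$-$C^*$-algebra if there is a net $(\theta_i\colon G\to Z(A^{**}))_{i\in I}$ of functions with values in the center of the enveloping von Neumann algebra $A^{**}$ such that each $\theta_i$ is finitely supported and of positive type (for all $g_1,\dots,g_n\in G$ the matrix $(\alpha^{**}_{g_k}(\theta_i(g_k^{-1}g_l)))_{k,l}\in M_n(A^{**})$ is positive), $\theta_i(e)\le 1$ for every $i$, and $\theta_i(g)\to 1$ ultraweakly for every $g\in G$. If $\bar{\mathfrak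 c}^{\mathrm{red}}G$ is an amenable $G$-$C^*$-algebra, then $G$ is amenable, i.e. there is a left-invariant finitely additive probability measure defined on all subsets of $G$. -/

import Mathlib

open Filter Topology
open scoped ENNReal BoundedContinuousFunction

/-! ## Amenable groups -/

/-- A discrete group is amenable if it carries a left-invariant, finitely additive probability
measure defined on all of its subsets. -/
def AmenableGroup (G : Type*) [Group G] : Prop :=
  ∃ μ : Set G → ℝ, (∀ s, 0 ≤ μ s) ∧ μ Set.univ = 1 ∧
    (∀ s t, Disjoint s t → μ (s ∪ t) = μ s + μ t) ∧
    ∀ (g : G) (s : Set G), μ ((fun x => g * x) '' s) = μ s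

/-! ## The bidual of a C*-algebra -/

section Bidual

variable (A : Type*) [CStarAlgebra A]

/-- The double dual of a C*-algebra. With the product `Bidual.mul`, the involution `Bidual.star`
and the unit `Bidual.one` below it is the enveloping von Neumann algebra of `A`. Its ultraweak
topology is the topology of pointwise convergence on `StrongDual ℂ A`. -/
abbrev Bidual : Type _ := StrongDual ℂ (StrongDual ℂ A)

variable {A}

namespace Bidual

/-- For `φ` in the dual and `n` in the double dual, the functional `a ↦ n (b ↦ φ (a * b))`. -/
noncomputable def act (n : Bidual A) : StrongDual ℂ A →L[ℂ] StrongDual ℂ A :=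
  ((ContinuousLinearMap.compL ℂ A (StrongDual ℂ A) ℂ) n) ∘L
    ((ContinuousLinearMap.compL ℂ A (A →L[ℂ] A) (StrongDual ℂ A)).flip
      (ContinuousLinearMap.mul ℂ A)) ∘L
    (ContinuousLinearMap.compL ℂ A A ℂ)

theorem act_apply (n : Bidual A) (φ : StrongDual ℂ A) (a : A) :
    act n φ a = n (φ ∘L ContinuousLinearMap.mul ℂ A a) := rfl

/-- The (Arens) product of the double dual, which is the unique extension of the product of `A`
that is separately continuous for the ultraweak topology. -/
noncomputable def mul (m n : Bidual A) : Bidual A := m ∘L act n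

theorem mul_apply (m n : Bidual A) (φ : StrongDual ℂ A) : mul m n φ = m (act n φ) := rfl

/-- The involution `φ ↦ φ*` of the dual, where `φ* a = conj (φ (a*))`. -/
noncomputable def dualStar : StrongDual ℂ A →L⋆[ℂ] StrongDual ℂ A :=
  LinearMap.mkContinuous
    { toFun := fun φ =>
        LinearMap.mkContinuous
          { toFun := fun a => Star.star (φ (Star.star a))
            map_add' := fun a b => by simp
            map_smul' := fun c a => by simp } ‖φ‖
          (fun a => by simpa using φ.le_opNorm (Star.star a))
      map_add' := fun φ ψ => by ext a; simp
      map_smul' := fun c φ => by ext a; simp } 1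
    (fun φ => by
      rw [one_mul]
      refine ContinuousLinearMap.opNorm_le_bound _ (norm_nonneg φ) fun a => ?_
      simpa using φ.le_opNorm (Star.star a))

theorem dualStar_apply (φ : StrongDual ℂ A) (a : A) :
    dualStar φ a = Star.star (φ (Star.star a)) := rfl

/-- The involution of the double dual, `m* φ = conj (m (φ*))`. -/
noncomputable def star (m : Bidual A) : Bidual A :=
  LinearMap.mkContinuous
    { toFun := fun φ => Star.star (m (dualStar φ))
      map_add' := fun φ ψ => by simp
      map_smul' := fun c φ => by simp } (‖m‖ * ‖(dualStar : StrongDual ℂ A →L⋆[ℂ] _)‖)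
    (fun φ => by
      have h1 := m.le_opNorm (dualStar φ)
      have h2 := (dualStar : StrongDual ℂ A →L⋆[ℂ] _).le_opNorm φ
      have h3 := mul_le_mul_of_nonneg_left h2 (norm_nonneg m)
      simpa [mul_assoc] using h1.trans h3)

theorem star_apply (m : Bidual A) (φ : StrongDual ℂ A) :
    star m φ = Star.star (m (dualStar φ)) := rfl

/-- The unit of the double dual. -/
noncomputable def one : Bidual A := NormedSpace.inclusionInDoubleDual ℂ A 1

theorem one_apply (φ : StrongDual ℂ A) : (one : Bidual A) φ = φ 1 := rfl

/-- `m` lies in the center of the double dual. -/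
def IsCentral (m : Bidual A) : Prop := ∀ n : Bidual A, mul m n = mul n m

/-- `M` is a positive element of the C*-algebra of matrices over the double dual, that is, it is
of the form `X* X`. -/
def IsPositiveMatrix {n : ℕ} (M : Matrix (Fin n) (Fin n) (Bidual A)) : Prop :=
  ∃ X : Matrix (Fin n) (Fin n) (Bidual A), ∀ i j, M i j = ∑ k, mul (star (X k i)) (X k j)

/-- The order of the double dual: `m ≤ n` if `n - m` is of the form `x* x`. -/
def Le (m n : Bidual A) : Prop := ∃ x : Bidual A, n - m = mul (star x) x

/-- The second adjoint of a *-automorphism `β` of `A`. -/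
noncomputable def map (β : A ≃⋆ₐ[ℂ] A) (m : Bidual A) : Bidual A :=
  m ∘L (ContinuousLinearMap.compL ℂ A A ℂ).flip
    ⟨β.toAlgEquiv.toLinearMap, (StarAlgEquiv.isometry β).continuous⟩

theorem map_apply (β : A ≃⋆ₐ[ℂ] A) (m : Bidual A) (φ : StrongDual ℂ A) :
    map β m φ = m (φ ∘L ⟨β.toAlgEquiv.toLinearMap, (StarAlgEquiv.isometry β).continuous⟩) := rfl

end Bidual

end Bidual

/-! ## Amenable actions on C*-algebras -/

section AmenableAction

variable {G : Type*} [Group G] {A : Type*} [CStarAlgebra A]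

/-- A function `θ : G → A**` is of positive type for the action `α` of `G` if for all
`g₁, …, gₙ` the matrix with entries `α_{gᵢ} (θ (gᵢ⁻¹ gⱼ))` is positive. -/
def IsPositiveType (α : G →* (A ≃⋆ₐ[ℂ] A)) (θ : G → Bidual A) : Prop :=
  ∀ (n : ℕ) (g : Fin n → G),
    Bidual.IsPositiveMatrix
      (Matrix.of fun i j => Bidual.map (α (g i)) (θ ((g i)⁻¹ * g j)))

end AmenableAction

/-- The (unital) `G`-C*-algebra `A` with action `α` of the discrete group `G` is amenable if there
is a net `(θᵢ)` of finitely supported positive type functions from `G` to the center of `A**` with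
`θᵢ(e) ≤ 1` for all `i`, and `θᵢ(g) → 1` ultraweakly for every `g`. -/
def IsAmenableGCStarAlgebra.{u, v} {G : Type u} [Group G] {A : Type v} [CStarAlgebra A]
    (α : G →* (A ≃⋆ₐ[ℂ] A)) : Prop :=
  ∃ (I : Type (max u v)) (_ : Preorder I) (_ : IsDirectedOrder I) (_ : Nonempty I)
    (θ : I → G → Bidual A),
    (∀ i g, Bidual.IsCentral (θ i g)) ∧
    (∀ i, IsPositiveType α (θ i)) ∧
    (∀ i, (Function.support (θ i)).Finite) ∧
    (∀ i, Bidual.Le (θ i 1) Bidual.one) ∧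
    ∀ (g : G) (φ : StrongDual ℂ A), Tendsto (fun i => θ i g φ) atTop (𝓝 (Bidual.one φ))

/-! ## Functions of vanishing variation -/

section Variation

variable {Y M : Type*} [MetricSpace Y] [MetricSpace M]

/-- The `r`-variation of a map between metric spaces. -/
noncomputable def variation (r : ℝ) (f : Y → M) (y : Y) : ℝ≥0∞ :=
  ⨆ (x : Y) (_ : dist y x ≤ r), edist (f y) (f x)

/-- For every `r > 0` the `r`-variation of the map converges to zero at infinity. -/
def HasVanishingVariation (f : Y → M) : Prop :=
  ∀ r > 0, Tendsto (variation r f) (cocompact Y) (𝓝 0)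

theorem hasVanishingVariation_iff {f : Y → M} : HasVanishingVariation f ↔
    ∀ r > 0, ∀ ε > 0, ∀ᶠ y in cocompact Y, ∀ x, dist y x ≤ r → dist (f y) (f x) ≤ ε := by
  unfold HasVanishingVariation
  refine forall₂_congr fun r _ => ?_
  rw [ENNReal.tendsto_nhds_zero]
  constructor
  · intro h ε hε
    filter_upwards [h (ENNReal.ofReal ε) (ENNReal.ofReal_pos.2 hε)] with y hy x hx
    rw [variation, iSup₂_le_iff] at hy
    exact (edist_le_ofReal hε.le).1 (hy x hx)
  · intro h ε hε
    rcases eq_or_ne ε ⊤ with rfl | hε'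
    · exact Eventually.of_forall fun _ => le_top
    · filter_upwards [h ε.toReal (ENNReal.toReal_pos hε.ne' hε')] with y hy
      refine iSup₂_le fun x hx => ?_
      rw [← ENNReal.ofReal_toReal hε']
      exact (edist_le_ofReal ENNReal.toReal_nonneg).2 (hy x hx)

end Variation

/-- The adjoint of a compact operator is compact. -/
theorem isCompactOperator_star {H : Type*} [NormedAddCommGroup H] [InnerProductSpace ℂ H]
    [CompleteSpace H] {T : H →L[ℂ] H} (hT : IsCompactOperator T) :
    IsCompactOperator (star T : H →L[ℂ] H) := by
  have hTT : IsCompactOperator (T ∘L star T : H →L[ℂ] H) := hT.comp_clm (star T)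
  have hK := (hTT.isCompact_closure_image_closedBall (f := (T ∘L star T).toLinearMap) 1)
  have htb : TotallyBounded ((T ∘L star T) '' Metric.closedBall (0 : H) 1) :=
    hK.totallyBounded.subset subset_closure
  refine (isCompactOperator_iff_isCompact_closure_image_closedBall
    (star T : H →L[ℂ] H).toLinearMap one_pos).2 ?_
  refine TotallyBounded.isCompact_of_isClosed (TotallyBounded.closure ?_) isClosed_closure
  rw [Metric.totallyBounded_iff]
  intro ε hε
  obtain ⟨t, hts, htf, htc⟩ :=
    Metric.finite_approx_of_totallyBounded htb (ε ^ 2 / 2) (by positivity)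
  have hts' : ∀ y ∈ t, ∃ p ∈ Metric.closedBall (0 : H) 1, (T ∘L star T) p = y := hts
  choose! p hp1 hp2 using hts'
  refine ⟨(fun y => (star T : H →L[ℂ] H) (p y)) '' t, htf.image _, ?_⟩
  rintro _ ⟨x, hx, rfl⟩
  obtain ⟨y, hy, hxy⟩ := Set.mem_iUnion₂.1 (htc ⟨x, hx, rfl⟩)
  refine Set.mem_iUnion₂.2 ⟨_, ⟨y, hy, rfl⟩, ?_⟩
  have hpy := hp1 y hy
  rw [mem_closedBall_zero_iff] at hpy hx
  rw [← hp2 y hy, Metric.mem_ball, dist_eq_norm, ← map_sub] at hxy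
  change dist ((star T : H →L[ℂ] H) x) _ < ε
  rw [dist_eq_norm, ← map_sub]
  set z := x - p y with hz
  have hz2 : ‖z‖ ≤ 2 := (norm_sub_le _ _).trans (by linarith)
  have key : ‖(star T : H →L[ℂ] H) z‖ ^ 2 ≤ ‖z‖ * ‖(T ∘L star T) z‖ := by
    have h1 : inner ℂ ((star T : H →L[ℂ] H) z) ((star T : H →L[ℂ] H) z)
        = inner ℂ z ((T ∘L star T) z) := by
      rw [ContinuousLinearMap.star_eq_adjoint, ContinuousLinearMap.adjoint_inner_left]
      rfl
    have h2 := norm_inner_le_norm (𝕜 := ℂ) z ((T ∘L star T) z)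
    rw [← h1, inner_self_eq_norm_sq_to_K] at h2
    simpa using h2
  have h3 : ‖(star T : H →L[ℂ] H) z‖ ^ 2 < ε ^ 2 := by
    have := norm_nonneg ((T ∘L star T) z)
    nlinarith
  exact lt_of_pow_lt_pow_left₀ 2 hε.le h3

/-! ## The reduced stable Higson compactification -/

section Translate

variable {G : Type*} [Group G] [MetricSpace G] [IsIsometricSMul G G]
variable {H : Type*} [NormedAddCommGroup H] [InnerProductSpace ℂ H]

/-- The left translate `x ↦ f (g⁻¹ x)` of a function. -/
noncomputable def leftTranslate (g : G) (f : G →ᵇ (H →L[ℂ] H)) : G →ᵇ (H →L[ℂ] H) :=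
  f.compContinuous ⟨fun x => g⁻¹ * x, (isometry_smul G g⁻¹).continuous⟩

theorem leftTranslate_apply (g : G) (f : G →ᵇ (H →L[ℂ] H)) (x : G) :
    leftTranslate g f x = f (g⁻¹ * x) := rfl

end Translate

section Higson

variable (G : Type*) [MetricSpace G]
variable (H : Type*) [NormedAddCommGroup H] [InnerProductSpace ℂ H] [CompleteSpace H]

/-- The reduced stable Higson compactification of `G` (with coefficients in the operators on `H`):
the C*-algebra of bounded continuous functions `f : G → B(H)` of vanishing variation such that
`f x - f y` is a compact operator for all `x` and `y`. -/
noncomputable def redStableHigson : StarSubalgebra ℂ (G →ᵇ (H →L[ℂ] H)) where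
  carrier := {f | HasVanishingVariation f ∧ ∀ x y, IsCompactOperator (f x - f y)}
  mul_mem' := by
    rintro f g ⟨hf, hf'⟩ ⟨hg, hg'⟩
    refine ⟨?_, fun x y => ?_⟩
    · rw [hasVanishingVariation_iff] at hf hg ⊢
      intro r hr ε hε
      have hδ : 0 < ε / (‖f‖ + ‖g‖ + 1) := by positivity
      filter_upwards [hf r hr _ hδ, hg r hr _ hδ] with y h1 h2 x hx
      have h1 := h1 x hx
      have h2 := h2 x hx
      rw [dist_eq_norm] at h1 h2 ⊢
      have e : (f * g) y - (f * g) x = f y * (g y - g x) + (f y - f x) * g x := by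
        simp only [BoundedContinuousFunction.mul_apply]
        noncomm_ring
      have n1 := f.norm_coe_le_norm y
      have n2 := g.norm_coe_le_norm x
      rw [e]
      calc _ ≤ ‖f y‖ * ‖g y - g x‖ + ‖f y - f x‖ * ‖g x‖ :=
            (norm_add_le _ _).trans (add_le_add (norm_mul_le _ _) (norm_mul_le _ _))
        _ ≤ ‖f‖ * (ε / (‖f‖ + ‖g‖ + 1)) + (ε / (‖f‖ + ‖g‖ + 1)) * ‖g‖ := by gcongr
        _ ≤ (ε / (‖f‖ + ‖g‖ + 1)) * (‖f‖ + ‖g‖ + 1) := by nlinarith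
        _ = ε := by field_simp
    · have e : ((f * g) x - (f * g) y : H →L[ℂ] H)
          = f x ∘L (g x - g y) + (f x - f y) ∘L g y := by
        simp only [BoundedContinuousFunction.mul_apply, ← ContinuousLinearMap.mul_def]
        noncomm_ring
      rw [e]
      exact ((hg' x y).clm_comp (f x)).add ((hf' x y).comp_clm (g y))
  add_mem' := by
    rintro f g ⟨hf, hf'⟩ ⟨hg, hg'⟩
    refine ⟨?_, fun x y => ?_⟩
    · rw [hasVanishingVariation_iff] at hf hg ⊢
      intro r hr ε hε
      filter_upwards [hf r hr _ (half_pos hε), hg r hr _ (half_pos hε)] with y h1 h2 x hx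
      exact (dist_add_add_le _ _ _ _).trans (by linarith [h1 x hx, h2 x hx])
    · have e : ((f + g) x - (f + g) y : H →L[ℂ] H) = (f x - f y) + (g x - g y) := by
        simp only [BoundedContinuousFunction.add_apply]
        abel
      rw [e]
      exact (hf' x y).add (hg' x y)
  algebraMap_mem' := by
    intro c
    refine ⟨?_, fun x y => ?_⟩
    · rw [hasVanishingVariation_iff]
      intro r hr ε hε
      refine Eventually.of_forall fun y x _ => ?_
      rw [BoundedContinuousFunction.algebraMap_apply, BoundedContinuousFunction.algebraMap_apply,
        dist_self]
      exact hε.le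
    · rw [BoundedContinuousFunction.algebraMap_apply, BoundedContinuousFunction.algebraMap_apply,
        sub_self]
      exact isCompactOperator_zero
  star_mem' := by
    rintro f ⟨hf, hf'⟩
    refine ⟨?_, fun x y => ?_⟩
    · rw [hasVanishingVariation_iff] at hf ⊢
      intro r hr ε hε
      filter_upwards [hf r hr ε hε] with y h x hx
      have := h x hx
      rw [dist_eq_norm] at this ⊢
      rwa [BoundedContinuousFunction.star_apply, BoundedContinuousFunction.star_apply, ← star_sub,
        norm_star]
    · rw [BoundedContinuousFunction.star_apply, BoundedContinuousFunction.star_apply, ← star_sub]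
      exact isCompactOperator_star (hf' x y)

variable {G H}

theorem mem_redStableHigson {f : G →ᵇ (H →L[ℂ] H)} : f ∈ redStableHigson G H ↔
    HasVanishingVariation f ∧ ∀ x y, IsCompactOperator (f x - f y) := Iff.rfl

variable (G H)

theorem isClosed_redStableHigson :
    IsClosed (redStableHigson G H : Set (G →ᵇ (H →L[ℂ] H))) := by
  have e : (redStableHigson G H : Set (G →ᵇ (H →L[ℂ] H))) =
      {f : G →ᵇ (H →L[ℂ] H) | HasVanishingVariation f} ∩
        ⋂ x, ⋂ y, {f : G →ᵇ (H →L[ℂ] H) | IsCompactOperator (f x - f y)} := by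
    ext f
    simp only [SetLike.mem_coe, mem_redStableHigson, Set.mem_inter_iff, Set.mem_iInter]
    rfl
  rw [e]
  refine IsClosed.inter ?_ (isClosed_iInter fun x => isClosed_iInter fun y => ?_)
  · refine isClosed_of_closure_subset fun f hf => ?_
    change HasVanishingVariation f
    rw [hasVanishingVariation_iff]
    intro r hr ε hε
    obtain ⟨g, hg, hfg⟩ := Metric.mem_closure_iff.1 hf (ε / 3) (by positivity)
    filter_upwards [hasVanishingVariation_iff.1 hg r hr (ε / 3) (by positivity)] with y hy x hx
    have h1 := BoundedContinuousFunction.dist_coe_le_dist (f := f) (g := g) y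
    have h2 := BoundedContinuousFunction.dist_coe_le_dist (f := f) (g := g) x
    have h3 := dist_triangle4 (f y) (g y) (g x) (f x)
    rw [dist_comm (g x) (f x)] at h3
    linarith [hy x hx]
  · have hc : Continuous fun f : G →ᵇ (H →L[ℂ] H) => f x - f y :=
      (continuous_eval_const x).sub (continuous_eval_const y)
    exact (isClosed_setOfPred_isCompactOperator (σ₁₂ := RingHom.id ℂ)
      (M₁ := H) (M₂ := H)).preimage hc

noncomputable instance : CStarAlgebra (redStableHigson G H) :=
  StarSubalgebra.cstarAlgebra _ (h_closed := isClosed_redStableHigson G H)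

variable {G H}
variable [Group G] [IsIsometricSMul G G]

theorem leftTranslate_mem (g : G) {f : G →ᵇ (H →L[ℂ] H)} (hf : f ∈ redStableHigson G H) :
    leftTranslate g f ∈ redStableHigson G H := by
  refine ⟨?_, fun x y => hf.2 _ _⟩
  have h := hasVanishingVariation_iff.1 hf.1
  rw [hasVanishingVariation_iff]
  intro r hr ε hε
  have ht : Tendsto (fun x : G => g⁻¹ * x) (cocompact G) (cocompact G) :=
    (IsometryEquiv.constSMul (X := G) g⁻¹).toHomeomorph.isClosedEmbedding.tendsto_cocompact
  filter_upwards [ht.eventually (h r hr ε hε)] with y hy x hx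
  exact hy (g⁻¹ * x) ((dist_smul g⁻¹ y x).trans_le hx)

variable (G H)

/-- The action of `G` on its reduced stable Higson compactification by left translation. -/
noncomputable def redStableHigsonAction :
    G →* (redStableHigson G H ≃⋆ₐ[ℂ] redStableHigson G H) where
  toFun g :=
    { toFun := fun f => ⟨leftTranslate g f, leftTranslate_mem g f.2⟩
      invFun := fun f => ⟨leftTranslate g⁻¹ f, leftTranslate_mem g⁻¹ f.2⟩
      left_inv := fun f => by
        ext x : 2
        simp [leftTranslate_apply]
      right_inv := fun f => by
        ext x : 2
        simp [leftTranslate_apply]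
      map_mul' := fun _ _ => rfl
      map_add' := fun _ _ => rfl
      map_star' := fun _ => rfl
      map_smul' := fun _ _ => rfl }
  map_one' := by
    ext f x : 3
    simp [leftTranslate_apply]
  map_mul' g h := by
    ext f x : 3
    change (f : G →ᵇ (H →L[ℂ] H)) ((g * h)⁻¹ * x) = (f : G →ᵇ (H →L[ℂ] H)) (h⁻¹ * (g⁻¹ * x))
    rw [mul_inv_rev, mul_assoc]

theorem redStableHigsonAction_apply (g : G) (f : redStableHigson G H) (x : G) :
    (redStableHigsonAction G H g f : G →ᵇ (H →L[ℂ] H)) x = (f : G →ᵇ (H →L[ℂ] H)) (g⁻¹ * x) := rfl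

end Higson

/-! Any two values of an element of the reduced stable Higson compactification differ by a compact
operator. Hence evaluation at `1`, followed by a state of B(H) that kills the compact operators, is
a translation-invariant state `φ` (`exists_invariant_state_redStableHigson`). Such a state of B(H)
exists because H is infinite-dimensional. Pairing the positive type functions `θ i` with `φ` gives
scalar functions `h i`. By GNS they are positive definite, since invariance of `φ` removes the twist
by the action (`IsPositiveType.sum_nonneg`). They are finitely supported and converge pointwise to
`φ 1 = 1`. The rest is Hulanicki's argument. Each `h i` is a coefficient of the left regular
representation at a vector `ξ i` (`exists_coefficient_of_positiveDefinite`). These vectors are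
asymptotically invariant, and an ultralimit of the measures with density `|ξ i|²` is an invariant
mean. -/

open scoped ComplexOrder

/-! ### Positivity in the bidual, tested by positive functionals. -/

section BidualPositivity

universe u

variable {A : Type u} [CStarAlgebra A]

theorem complex_inner_self_nonneg {E : Type*} [SeminormedAddCommGroup E]
    [InnerProductSpace ℂ E] (x : E) : 0 ≤ inner ℂ x x := by
  rw [inner_self_eq_norm_sq_to_K]
  exact pow_nonneg (Complex.zero_le_real.2 (norm_nonneg x)) 2

/-- The Hilbert space of the GNS construction of a positive functional. -/
theorem exists_gns (φ : StrongDual ℂ A) (hφ : ∀ a, 0 ≤ φ (star a * a)) :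
    ∃ (K : Type u) (_ : NormedAddCommGroup K) (_ : InnerProductSpace ℂ K) (_ : CompleteSpace K)
      (T : A →L[ℂ] K), ∀ a b, inner ℂ (T a) (T b) = φ (star a * b) := by
  let _ := CStarAlgebra.spectralOrder A
  let _ := CStarAlgebra.spectralOrderedRing A
  let f : A →ₚ[ℂ] ℂ := PositiveLinearMap.mk₀ (φ : A →ₗ[ℂ] ℂ) (by
    intro x hx
    obtain ⟨b, rfl⟩ := CStarAlgebra.nonneg_iff_eq_star_mul_self.1 hx
    exact hφ b)
  let T₀ : A →L[ℂ] f.PreGNS := f.toPreGNS.toLinearMap.mkContinuous (√‖φ‖) (by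
    intro a
    have h1 : ((‖f.toPreGNS a‖ ^ 2 : ℝ) : ℂ) = φ (star a * a) := by
      rw [Complex.ofReal_pow, f.preGNS_norm_sq]
      rfl
    have h2 : ‖f.toPreGNS a‖ ^ 2 ≤ ‖φ‖ * (‖a‖ * ‖a‖) := by
      have h3 := φ.le_opNorm (star a * a)
      rw [← h1, Complex.norm_real, Real.norm_of_nonneg (sq_nonneg _),
        CStarRing.norm_star_mul_self] at h3
      exact h3
    refine le_of_sq_le_sq ?_ (by positivity)
    rw [mul_pow, Real.sq_sqrt (norm_nonneg _), sq ‖a‖]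
    exact h2)
  refine ⟨f.GNS, inferInstance, inferInstance, inferInstance,
    (UniformSpace.Completion.toComplL (𝕜 := ℂ) (E := f.PreGNS)) ∘L T₀, fun a b => ?_⟩
  change inner ℂ ((f.toPreGNS a : f.PreGNS) : f.GNS) ((f.toPreGNS b : f.PreGNS) : f.GNS) = _
  rw [UniformSpace.Completion.inner_coe]
  rfl

namespace Bidual

/-- An element of the double dual defines a vector of every Hilbert space to which `A` maps. -/
theorem exists_vector {K : Type*} [NormedAddCommGroup K] [InnerProductSpace ℂ K]
    [CompleteSpace K] (T : A →L[ℂ] K) (n : Bidual A) :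
    ∃ k : K, ∀ v : K, n (innerSL ℂ v ∘L T) = inner ℂ v k := by
  -- `v ↦ n ⟨v, T ·⟩` is conjugate-linear; its conjugate is a bounded functional, to which Riesz
  -- applies.
  let ℓ : StrongDual ℂ K :=
    ((starL ℂ : ℂ ≃L⋆[ℂ] ℂ) : ℂ →L⋆[ℂ] ℂ) ∘SL
      ((n ∘L (ContinuousLinearMap.compL ℂ A K ℂ).flip T) ∘SL (innerSL ℂ : K →L⋆[ℂ] K →L[ℂ] ℂ))
  refine ⟨(InnerProductSpace.toDual ℂ K).symm ℓ, fun v => ?_⟩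
  rw [← inner_conj_symm, InnerProductSpace.toDual_symm_apply]
  exact (star_star (n (innerSL ℂ v ∘L T))).symm

/-- A positive functional turns `m* n` into an inner product. -/
theorem exists_inner_eq (φ : StrongDual ℂ A) (hφ : ∀ a, 0 ≤ φ (Star.star a * a)) :
    ∃ (K : Type u) (_ : NormedAddCommGroup K) (_ : InnerProductSpace ℂ K) (κ : Bidual A → K),
      ∀ m n, mul (star m) n φ = inner ℂ (κ m) (κ n) := by
  obtain ⟨K, _, _, _, T, hT⟩ := exists_gns φ hφ
  choose κ hκ using exists_vector (A := A) T
  refine ⟨K, inferInstance, inferInstance, κ, fun m n => ?_⟩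
  -- `φ (a* b) = ⟨T a, T b⟩`, so `act n φ` sends `a*` to `⟨T a, κ n⟩`; conjugate.
  have h : dualStar (act n φ) = innerSL ℂ (κ n) ∘L T := by
    ext a
    have e : φ ∘L ContinuousLinearMap.mul ℂ A (Star.star a) = innerSL ℂ (T a) ∘L T := by
      ext b
      exact (hT a b).symm
    rw [dualStar_apply, act_apply, e, hκ]
    exact inner_conj_symm _ _
  rw [mul_apply, star_apply, h, hκ]
  exact inner_conj_symm _ _

/-- A positive functional turns positive matrices into positive semidefinite ones. -/
theorem IsPositiveMatrix.sum_nonneg {φ : StrongDual ℂ A} (hφ : ∀ a, 0 ≤ φ (Star.star a * a))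
    {n : ℕ} {M : Matrix (Fin n) (Fin n) (Bidual A)} (hM : IsPositiveMatrix M) (c : Fin n → ℂ) :
    0 ≤ ∑ i, ∑ j, Star.star (c i) * c j * M i j φ := by
  obtain ⟨X, hX⟩ := hM
  obtain ⟨K, _, _, κ, hκ⟩ := exists_inner_eq φ hφ
  -- Since `M = X* X`, the form is a sum of squared norms. Linearity of `κ` is not needed.
  have e : ∑ i, ∑ j, Star.star (c i) * c j * M i j φ =
      ∑ k, inner ℂ (∑ i, c i • κ (X k i)) (∑ i, c i • κ (X k i)) := by
    simp only [hX, sum_inner, inner_sum, inner_smul_left, inner_smul_right]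
    simp only [_root_.sum_apply, hκ, Finset.mul_sum]
    rw [Finset.sum_comm]
    conv_rhs => rw [Finset.sum_comm]
    refine Finset.sum_congr rfl fun j _ => ?_
    rw [Finset.sum_comm]
    refine Finset.sum_congr rfl fun k _ => Finset.sum_congr rfl fun i _ => ?_
    rw [mul_comm (Star.star (c i)), mul_assoc]
    rfl
  rw [e]
  exact Finset.sum_nonneg fun k _ => complex_inner_self_nonneg _

end Bidual

end BidualPositivity

/-! ### An invariant state on the reduced stable Higson compactification. -/

section InvariantState

/-- An infinite-dimensional Hilbert space contains an orthonormal sequence. -/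
theorem exists_orthonormal_nat {H : Type*} [NormedAddCommGroup H] [InnerProductSpace ℂ H]
    [CompleteSpace H] (hH : ¬ FiniteDimensional ℂ H) : ∃ e : ℕ → H, Orthonormal ℂ e := by
  obtain ⟨w, b, hb⟩ := exists_hilbertBasis ℂ H
  have hw : Infinite w := by
    by_contra hw
    rw [not_infinite_iff_finite] at hw
    have := Fintype.ofFinite w
    exact hH (b.toOrthonormalBasis.toBasis.finiteDimensional_of_finite)
  exact ⟨b ∘ Infinite.natEmbedding w, b.orthonormal.comp _ (Infinite.natEmbedding w).injective⟩

variable {H : Type*} [NormedAddCommGroup H] [InnerProductSpace ℂ H]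

/-- Bessel's inequality makes the squared coefficients summable. -/
theorem Orthonormal.tendsto_inner_zero {e : ℕ → H} (he : Orthonormal ℂ e) (z : H) :
    Tendsto (fun n => inner ℂ (e n) z) cofinite (𝓝 0) := by
  have h := (he.inner_products_summable (x := z)).tendsto_cofinite_zero
  rw [tendsto_zero_iff_norm_tendsto_zero]
  simpa using h.sqrt

/-- The diagonal coefficients of a compact operator tend to zero. -/
theorem Orthonormal.tendsto_inner_apply_zero {e : ℕ → H} (he : Orthonormal ℂ e)
    {T : H →L[ℂ] H} (hT : IsCompactOperator T) {U : Ultrafilter ℕ}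
    (hU : (U : Filter ℕ) ≤ cofinite) :
    Tendsto (fun n => inner ℂ (e n) (T (e n))) U (𝓝 0) := by
  obtain ⟨C, hC, hTC⟩ := hT.image_closedBall_subset_compact (f := T.toLinearMap) 1
  -- By compactness `T (e n)` has a norm limit `z` along `U`. Split `T (e n)` as `(T (e n) - z) +
  -- z`: the first term is small in norm, and the second pairs to zero with `e n`.
  obtain ⟨z, -, hz⟩ := hC.ultrafilter_le_nhds (U.map fun n => T (e n)) (by
    rw [Ultrafilter.coe_map, le_principal_iff]
    refine mem_map.2 (Eventually.of_forall fun n => hTC ⟨e n, ?_, rfl⟩)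
    simp [he.1 n])
  have hz' : Tendsto (fun n => T (e n)) U (𝓝 z) := hz
  have h1 : Tendsto (fun n => inner ℂ (e n) (T (e n) - z)) U (𝓝 0) := by
    refine squeeze_zero_norm (fun n => ?_) (tendsto_iff_norm_sub_tendsto_zero.1 hz')
    simpa only [he.1 n, one_mul] using norm_inner_le_norm (𝕜 := ℂ) (e n) (T (e n) - z)
  have h2 := h1.add ((he.tendsto_inner_zero z).mono_left hU)
  simpa [inner_sub_right] using h2

/-- Closed balls are compact; this supplies the ultralimits defining both the state and the mean. -/
theorem exists_tendsto_of_norm_le {ι E : Type*} [SeminormedAddCommGroup E] [ProperSpace E]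
    (U : Ultrafilter ι) {u : ι → E} {C : ℝ} (hu : ∀ᶠ n in U, ‖u n‖ ≤ C) :
    ∃ l, Tendsto u U (𝓝 l) := by
  obtain ⟨l, -, hl⟩ := (isCompact_closedBall (0 : E) C).ultrafilter_le_nhds (U.map u) (by
    rw [Ultrafilter.coe_map, le_principal_iff]
    exact mem_map.2 (hu.mono fun n hn => by simpa using hn))
  exact ⟨l, hl⟩

/-- There is a state on the bounded operators that vanishes on the compact ones. -/
theorem exists_state_compact_eq_zero [CompleteSpace H] (hH : ¬ FiniteDimensional ℂ H) :
    ∃ ω : StrongDual ℂ (H →L[ℂ] H), (∀ T, 0 ≤ ω (star T * T)) ∧ ω 1 = 1 ∧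
      ∀ T : H →L[ℂ] H, IsCompactOperator T → ω T = 0 := by
  obtain ⟨e, he⟩ := exists_orthonormal_nat hH
  -- The state is the ultralimit of the vector states at `e n`; `U` must be nonprincipal for compact
  -- operators to vanish.
  let U := hyperfilter ℕ
  have hb : ∀ (T : H →L[ℂ] H) n, ‖inner ℂ (e n) (T (e n))‖ ≤ ‖T‖ := fun T n => by
    have h1 := norm_inner_le_norm (𝕜 := ℂ) (e n) (T (e n))
    have h2 := T.le_opNorm (e n)
    rw [he.1 n] at h1 h2
    linarith
  choose ω hω using fun T : H →L[ℂ] H =>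
    exists_tendsto_of_norm_le U (Eventually.of_forall (hb T))
  have uniq : ∀ {T l}, Tendsto (fun n => inner ℂ (e n) (T (e n))) U (𝓝 l) → ω T = l :=
    fun {T l} h => tendsto_nhds_unique (hω T) h
  refine ⟨LinearMap.mkContinuous
    { toFun := ω
      map_add' := fun S T => uniq (by simpa [inner_add_right] using (hω S).add (hω T))
      map_smul' := fun c T => uniq (by simpa [inner_smul_right] using (hω T).const_mul c) } 1
    fun T => ?_, fun T => ?_, ?_, fun T hT => ?_⟩
  · rw [one_mul]
    exact le_of_tendsto (hω T).norm (Eventually.of_forall (hb T))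
  · refine ge_of_tendsto (hω (star T * T)) (Eventually.of_forall fun n => ?_)
    rw [_root_.mul_apply_eq_comp, ContinuousLinearMap.star_eq_adjoint,
      ContinuousLinearMap.adjoint_inner_right]
    exact complex_inner_self_nonneg _
  · exact uniq (by simp [he.1])
  · exact uniq (he.tendsto_inner_apply_zero hT (hyperfilter_le_cofinite))

/-- The reduced stable Higson compactification has an invariant state. -/
theorem exists_invariant_state_redStableHigson (G : Type*) [Group G] [MetricSpace G]
    [IsIsometricSMul G G] [CompleteSpace H] (hH : ¬ FiniteDimensional ℂ H) :
    ∃ φ : StrongDual ℂ (redStableHigson G H), (∀ a, 0 ≤ φ (star a * a)) ∧ φ 1 = 1 ∧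
      ∀ g a, φ (redStableHigsonAction G H g a) = φ a := by
  obtain ⟨ω, hpos, hone, hcomp⟩ := exists_state_compact_eq_zero hH
  let ev : redStableHigson G H →L[ℂ] (H →L[ℂ] H) :=
    (BoundedContinuousFunction.evalCLM ℂ (1 : G)) ∘L
      (redStableHigson G H).toSubalgebra.toSubmodule.subtypeL
  refine ⟨ω ∘L ev, fun a => hpos (ev a), hone, fun g a => ?_⟩
  rw [← sub_eq_zero, ← map_sub, ContinuousLinearMap.comp_apply]
  exact hcomp _ (a.2.2 (g⁻¹ * 1) 1)

end InvariantState

/-! ### Positive definite functions of finite support and invariant means. -/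

section Hulanicki

/-- A positive operator on a Hilbert space has a square root that commutes with every operator
with which it commutes. -/
theorem exists_sqrt_of_nonneg {E : Type*} [NormedAddCommGroup E] [InnerProductSpace ℂ E]
    [CompleteSpace E] {T : E →L[ℂ] E} (hT : 0 ≤ T) :
    ∃ S : E →L[ℂ] E, IsSelfAdjoint S ∧ S * S = T ∧ ∀ R, Commute T R → Commute S R :=
  ⟨CFC.sqrt T, (CFC.sqrt_nonneg T).isSelfAdjoint, CFC.sqrt_mul_sqrt_self T,
    fun _ hR => hR.cfcₙ_nnreal _⟩

/-- Square-summable functions. -/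
local notation "L2(" X ")" => lp (fun _ : X => ℂ) 2

theorem lp_two_hasSum_norm_sq {X : Type*} (ξ : L2(X)) :
    HasSum (fun x => ‖ξ x‖ ^ 2) (‖ξ‖ ^ 2) := by
  simpa using lp.hasSum_norm (p := 2) (by simp) ξ

/-- Composition of square-summable functions with a permutation. -/
noncomputable def lpComp {X : Type*} (σ : Equiv.Perm X) : L2(X) →L[ℂ] L2(X) :=
  LinearMap.mkContinuous
    { toFun := fun ξ => ⟨fun x => ξ (σ x), memℓp_gen (by
        simpa [Function.comp_def] using
          (σ.summable_iff (f := fun x => ‖ξ x‖ ^ 2)).2 (lp_two_hasSum_norm_sq ξ).summable)⟩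
      map_add' := fun _ _ => rfl
      map_smul' := fun _ _ => rfl } 1
    (fun ξ => by
      rw [one_mul]
      refine le_of_sq_le_sq (le_of_eq ?_) (norm_nonneg _)
      refine (lp_two_hasSum_norm_sq _).unique ?_
      exact (σ.hasSum_iff (f := fun x => ‖ξ x‖ ^ 2)).2 (lp_two_hasSum_norm_sq ξ))

theorem lpComp_apply {X : Type*} (σ : Equiv.Perm X) (ξ : L2(X)) (x : X) :
    lpComp σ ξ x = ξ (σ x) := rfl

theorem norm_lpComp {X : Type*} (σ : Equiv.Perm X) (ξ : L2(X)) : ‖lpComp σ ξ‖ = ‖ξ‖ := by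
  have h : ‖lpComp σ ξ‖ ^ 2 = ‖ξ‖ ^ 2 := (lp_two_hasSum_norm_sq _).unique
    ((σ.hasSum_iff (f := fun x => ‖ξ x‖ ^ 2)).2 (lp_two_hasSum_norm_sq ξ))
  exact (sq_eq_sq₀ (norm_nonneg _) (norm_nonneg _)).1 h

/-- An operator on square-summable functions whose finite sections are positive is positive. -/
theorem nonneg_of_sum_single_nonneg {X : Type*} [DecidableEq X] {T : L2(X) →L[ℂ] L2(X)}
    (hT : ∀ (s : Finset X) (c : X → ℂ),
      0 ≤ ∑ x ∈ s, ∑ y ∈ s, star (c x) * c y * T (lp.single 2 y 1) x) : 0 ≤ T := by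
  have key : ∀ ξ : L2(X), 0 ≤ inner ℂ ξ (T ξ) := fun ξ => by
    -- Finite truncations of `ξ` approximate it, so positivity on finite sections passes to the
    -- limit.
    have h1 : Tendsto (fun s : Finset X => ∑ x ∈ s, lp.single 2 x (ξ x)) atTop (𝓝 ξ) :=
      lp.hasSum_single (by simp) ξ
    have h2 : Continuous fun η : L2(X) => inner ℂ η (T η) := by fun_prop
    refine ge_of_tendsto ((h2.tendsto ξ).comp h1) (Eventually.of_forall fun s => ?_)
    have e : ∀ x, lp.single 2 x (ξ x) = ξ x • (lp.single 2 x 1 : L2(X)) := fun x => by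
      rw [← lp.single_smul, smul_eq_mul, mul_one]
    refine (hT s fun x => ξ x).trans_eq ?_
    simp only [Function.comp_apply, e, sum_inner, map_sum, inner_sum, inner_smul_left,
      map_smul, inner_smul_right, lp.inner_single_left]
    simp only [Finset.mul_sum]
    rw [Finset.sum_comm]
    refine Finset.sum_congr rfl fun y _ => Finset.sum_congr rfl fun x _ => ?_
    simp [mul_left_comm, mul_assoc]
  rw [ContinuousLinearMap.nonneg_iff_isPositive, ContinuousLinearMap.isPositive_iff_complex]
  intro ξ
  have h := key ξ
  rw [← inner_conj_symm, Complex.le_def] at h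
  simp only [Complex.zero_re, Complex.conj_re, Complex.zero_im, Complex.conj_im] at h
  exact ⟨Complex.ext (by simp) (by simp; linarith [h.2]), h.1⟩

/-- The part of the squared norm of a square-summable function that comes from a set. -/
noncomputable def lpMass {X : Type*} (ξ : L2(X)) (s : Set X) : ℝ := ∑' x, s.indicator (fun x => ‖ξ x‖ ^ 2) x

theorem summable_lpMass {X : Type*} (ξ : L2(X)) (s : Set X) :
    Summable (s.indicator fun x => ‖ξ x‖ ^ 2) :=
  (lp_two_hasSum_norm_sq ξ).summable.indicator s

theorem lpMass_nonneg {X : Type*} (ξ : L2(X)) (s : Set X) : 0 ≤ lpMass ξ s :=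
  tsum_nonneg fun _ => Set.indicator_nonneg (fun _ _ => by positivity) _

theorem lpMass_univ {X : Type*} (ξ : L2(X)) : lpMass ξ Set.univ = ‖ξ‖ ^ 2 := by
  simpa [lpMass] using (lp_two_hasSum_norm_sq ξ).tsum_eq

theorem lpMass_le {X : Type*} (ξ : L2(X)) (s : Set X) : lpMass ξ s ≤ ‖ξ‖ ^ 2 := by
  rw [← (lp_two_hasSum_norm_sq ξ).tsum_eq]
  exact (summable_lpMass ξ s).tsum_le_tsum
    (fun x => Set.indicator_le_self' (fun _ _ => by positivity) x)
    (lp_two_hasSum_norm_sq ξ).summable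

theorem lpMass_union {X : Type*} (ξ : L2(X)) {s t : Set X} (h : Disjoint s t) :
    lpMass ξ (s ∪ t) = lpMass ξ s + lpMass ξ t := by
  rw [lpMass, lpMass, lpMass, ← (summable_lpMass ξ s).tsum_add (summable_lpMass ξ t),
    Set.indicator_union_of_disjoint h]

/-- Pointwise this is `(a + b)² ≤ (1 + t) a² + (1 + t⁻¹) b²`. The parameter `t` stays free so that
it can tend to `0` once `‖ξ - η‖` has vanished in the limit. -/
theorem lpMass_le_add {X : Type*} (ξ η : L2(X)) (s : Set X) {t : ℝ} (ht : 0 < t) :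
    lpMass ξ s ≤ (1 + t) * lpMass η s + (1 + t⁻¹) * ‖ξ - η‖ ^ 2 := by
  refine le_trans ?_ (add_le_add_right (mul_le_mul_of_nonneg_left (lpMass_le (ξ - η) s)
    (by positivity)) _)
  rw [lpMass, lpMass, lpMass, ← tsum_mul_left, ← tsum_mul_left,
    ← ((summable_lpMass η s).mul_left _).tsum_add ((summable_lpMass (ξ - η) s).mul_left _)]
  refine (summable_lpMass ξ s).tsum_le_tsum (fun x => ?_)
    (((summable_lpMass η s).mul_left _).add ((summable_lpMass (ξ - η) s).mul_left _))
  by_cases hx : x ∈ s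
  · simp only [Set.indicator_of_mem hx]
    have h1 : ‖ξ x‖ ≤ ‖η x‖ + ‖(ξ - η) x‖ := by
      have := norm_add_le (η x) ((ξ - η) x)
      rwa [lp.coeFn_sub, Pi.sub_apply, add_sub_cancel] at this
    set a := ‖η x‖
    set b := ‖(ξ - η) x‖
    calc ‖ξ x‖ ^ 2 ≤ (a + b) ^ 2 := by gcongr
      _ ≤ (a + b) ^ 2 + t⁻¹ * (t * a - b) ^ 2 := le_add_of_nonneg_right (by positivity)
      _ = _ := by field_simp; ring
  · simp [Set.indicator_of_notMem hx]

variable {G : Type*} [Group G]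

/-- Left translation of square-summable functions. -/
noncomputable def lpLeft (g : G) : L2(G) →L[ℂ] L2(G) := lpComp (Equiv.mulLeft g⁻¹)

theorem lpLeft_apply (g : G) (ξ : L2(G)) (x : G) : lpLeft g ξ x = ξ (g⁻¹ * x) := rfl

/-- A finitely supported positive definite function is a coefficient of the left regular
representation. -/
theorem exists_coefficient_of_positiveDefinite {h : G → ℂ} (hfin : (Function.support h).Finite)
    (hpos : ∀ (s : Finset G) (c : G → ℂ),
      0 ≤ ∑ x ∈ s, ∑ y ∈ s, star (c x) * c y * h (x⁻¹ * y)) :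
    ∃ ξ : L2(G), ∀ g, h g = inner ℂ ξ (lpLeft g ξ) := by
  classical
  -- A finite combination of right translations: bounded, with matrix entries `h (x⁻¹ y)`, and
  -- commuting with left translations.
  let T : L2(G) →L[ℂ] L2(G) := ∑ k ∈ hfin.toFinset, h k • lpComp (Equiv.mulRight k)
  have hT : ∀ ξ x, T ξ x = ∑ k ∈ hfin.toFinset, h k * ξ (x * k) := fun ξ x => by
    rw [_root_.sum_apply, lp.coeFn_sum, Finset.sum_apply]
    rfl
  have hTs : ∀ x y, T (lp.single 2 y 1) x = h (x⁻¹ * y) := fun x y => by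
    rw [hT, Finset.sum_eq_single (x⁻¹ * y)]
    · simp
    · intro k _ hk
      rw [lp.single_apply_ne, mul_zero]
      rintro rfl
      simp at hk
    · intro hk
      have : h (x⁻¹ * y) = 0 := by simpa using hk
      rw [this, zero_mul]
  have hT0 : 0 ≤ T := nonneg_of_sum_single_nonneg fun s c => by
    simpa only [hTs] using hpos s c
  obtain ⟨S, hS, hSS, hSc⟩ := exists_sqrt_of_nonneg hT0
  have hcomm : ∀ g, Commute S (lpLeft g) := fun g => by
    refine hSc _ (?_ : T * lpLeft g = lpLeft g * T)
    ext ξ x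
    simp only [_root_.mul_apply_eq_comp, lpLeft_apply, hT, mul_assoc]
  -- With `S = √T` commuting with left translations, `⟨S δ₁, λ_g S δ₁⟩ = ⟨S δ₁, S δ_g⟩ = ⟨δ₁, T δ_g⟩
  -- = h g`.
  refine ⟨S (lp.single 2 1 1), fun g => ?_⟩
  have e : lpLeft g (lp.single 2 1 1) = (lp.single 2 g 1 : L2(G)) := by
    ext x
    by_cases hx : x = g
    · subst hx
      simp [lpLeft_apply]
    · rw [lpLeft_apply, lp.single_apply_ne _ _ _ hx, lp.single_apply_ne]
      rwa [Ne, inv_mul_eq_one, eq_comm]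
  rw [← _root_.mul_apply_eq_comp, ← (hcomm g).eq, _root_.mul_apply_eq_comp, e,
    ← ContinuousLinearMap.adjoint_inner_right, ← ContinuousLinearMap.star_eq_adjoint, hS.star_eq,
    ← _root_.mul_apply_eq_comp, hSS, lp.inner_single_left, hTs]
  simp

theorem lpMass_image (ξ : L2(G)) (g : G) (s : Set G) :
    lpMass ξ ((fun x => g * x) '' s) = lpMass (lpLeft g⁻¹ ξ) s := by
  rw [lpMass, lpMass, ← (Equiv.mulLeft g).tsum_eq]
  refine tsum_congr fun x => ?_
  by_cases hx : x ∈ s <;> simp [hx, Set.indicator, lpLeft_apply]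

/-- A group is amenable if there are finitely supported positive definite functions on it that
converge pointwise to `1`. -/
theorem amenableGroup_of_positiveDefinite {I : Type*} {l : Filter I} [l.NeBot] {h : I → G → ℂ}
    (hfin : ∀ i, (Function.support (h i)).Finite)
    (hpos : ∀ i (s : Finset G) (c : G → ℂ),
      0 ≤ ∑ x ∈ s, ∑ y ∈ s, star (c x) * c y * h i (x⁻¹ * y))
    (hlim : ∀ g, Tendsto (fun i => h i g) l (𝓝 1)) : AmenableGroup G := by
  choose ξ hξ using fun i => exists_coefficient_of_positiveDefinite (hfin i) (hpos i)
  let U := Ultrafilter.of l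
  have hU : (U : Filter I) ≤ l := Ultrafilter.of_le l
  have hre : ∀ g, Tendsto (fun i => (h i g).re) U (𝓝 1) := fun g =>
    (Complex.continuous_re.tendsto 1).comp ((hlim g).mono_left hU)
  have hnorm : ∀ i, ‖ξ i‖ ^ 2 = (h i 1).re := fun i => by
    have e : lpLeft 1 (ξ i) = ξ i := by
      ext x
      simp [lpLeft_apply]
    rw [hξ, e, inner_self_eq_norm_sq_to_K]
    norm_cast
  have hsub : ∀ g, Tendsto (fun i => ‖lpLeft g (ξ i) - ξ i‖ ^ 2) U (𝓝 0) := fun g => by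
    have e : ∀ i, ‖lpLeft g (ξ i) - ξ i‖ ^ 2 = 2 * (h i 1).re - 2 * (h i g).re := fun i => by
      have h1 := norm_sub_sq (𝕜 := ℂ) (ξ i) (lpLeft g (ξ i))
      have h2 : ‖lpLeft g (ξ i)‖ = ‖ξ i‖ := norm_lpComp _ _
      rw [norm_sub_rev, h1, h2, ← hξ, hnorm]
      simp only [RCLike.re_eq_complex_re]
      ring
    simp only [e]
    simpa using ((hre 1).const_mul 2).sub ((hre g).const_mul 2)
  -- `‖ξ i‖² = Re (h i 1)` tends to `1`, hence is eventually below `2`.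
  have hbd : ∀ s, ∀ᶠ i in U, ‖lpMass (ξ i) s‖ ≤ 2 := fun s => by
    filter_upwards [(hre 1).eventually (gt_mem_nhds one_lt_two)] with i hi
    rw [Real.norm_of_nonneg (lpMass_nonneg _ _)]
    linarith [lpMass_le (ξ i) s, hnorm i]
  choose μ hμ using fun s => exists_tendsto_of_norm_le U (hbd s)
  -- Pass to the limit along `U` for fixed `t`, then let `t → 0`. The reverse inequality follows by
  -- applying this to `g⁻¹` and the translated set.
  have hle : ∀ g s, μ ((fun x => g * x) '' s) ≤ μ s := fun g s => by
    have h1 : ∀ t : ℝ, 0 < t → μ ((fun x => g * x) '' s) ≤ (1 + t) * μ s := fun t ht => by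
      have h2 := ((hμ s).const_mul (1 + t)).add ((hsub g⁻¹).const_mul (1 + t⁻¹))
      rw [mul_zero, add_zero] at h2
      refine le_of_tendsto_of_tendsto' (hμ _) h2 fun i => ?_
      rw [lpMass_image]
      exact lpMass_le_add _ _ _ ht
    have h3 : Tendsto (fun t : ℝ => (1 + t) * μ s) (𝓝[>] 0) (𝓝 ((1 + 0) * μ s)) :=
      ((by fun_prop : Continuous fun t : ℝ => (1 + t) * μ s).tendsto 0).mono_left
        nhdsWithin_le_nhds
    rw [add_zero, one_mul] at h3
    exact ge_of_tendsto h3 (eventually_mem_nhdsWithin.mono fun t ht => h1 t ht)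
  refine ⟨μ, fun s => ge_of_tendsto (hμ s) (Eventually.of_forall fun i => lpMass_nonneg _ _),
    tendsto_nhds_unique (hμ _) ?_, fun s t hst => ?_, fun g s => le_antisymm (hle g s) ?_⟩
  · simpa only [lpMass_univ, hnorm] using hre 1
  · refine tendsto_nhds_unique (hμ _) ?_
    simpa only [lpMass_union _ hst] using (hμ s).add (hμ t)
  · have h1 := hle g⁻¹ ((fun x => g * x) '' s)
    rwa [Set.image_image, show (fun x => g⁻¹ * (g * x)) = id from funext fun x => by simp,
      Set.image_id] at h1

end Hulanicki

/-! ### From an amenable action with an invariant state to amenability of the group. -/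

section InvariantStateAmenable

variable {G : Type*} [Group G] {A : Type*} [CStarAlgebra A]

/-- An invariant positive functional turns functions of positive type into positive definite
functions. -/
theorem IsPositiveType.sum_nonneg {α : G →* (A ≃⋆ₐ[ℂ] A)} {θ : G → Bidual A}
    (hθ : IsPositiveType α θ) {φ : StrongDual ℂ A} (hφ : ∀ a, 0 ≤ φ (star a * a))
    (hinv : ∀ g a, φ (α g a) = φ a) (s : Finset G) (c : G → ℂ) :
    0 ≤ ∑ x ∈ s, ∑ y ∈ s, star (c x) * c y * θ (x⁻¹ * y) φ := by
  let e := s.equivFin.symm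
  have h := (hθ s.card fun i => (e i : G)).sum_nonneg hφ fun i => c (e i)
  refine h.trans_eq ?_
  have hmap : ∀ g m, Bidual.map (α g) m φ = m φ := fun g m => by
    rw [Bidual.map_apply]
    congr 1
    ext a
    exact hinv g a
  simp only [Matrix.of_apply, hmap]
  rw [← Finset.sum_coe_sort s, ← e.sum_comp]
  refine Finset.sum_congr rfl fun i _ => ?_
  rw [← Finset.sum_coe_sort s, ← e.sum_comp]

/-- A group that acts amenably on a C*-algebra with an invariant state is amenable. -/
theorem IsAmenableGCStarAlgebra.amenableGroup {α : G →* (A ≃⋆ₐ[ℂ] A)}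
    (hα : IsAmenableGCStarAlgebra α) {φ : StrongDual ℂ A} (hφ : ∀ a, 0 ≤ φ (star a * a))
    (hone : φ 1 = 1) (hinv : ∀ g a, φ (α g a) = φ a) : AmenableGroup G := by
  obtain ⟨I, _, _, _, θ, -, hpos, hfin, -, hlim⟩ := hα
  refine amenableGroup_of_positiveDefinite (l := (atTop : Filter I)) (h := fun i g => θ i g φ)
    (fun i => (hfin i).subset fun g hg h0 => hg ?_)
    (fun i => (hpos i).sum_nonneg hφ hinv) fun g => ?_
  · change θ i g φ = 0
    rw [h0]
    rfl
  · simpa [Bidual.one_apply, hone] using hlim g φ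

end InvariantStateAmenable

theorem mainTheorem8 (G : Type*) [Group G] [Countable G]
    [MetricSpace G] [DiscreteTopology G] [ProperSpace G] [IsIsometricSMul G G]
    (H : Type*) [NormedAddCommGroup H] [InnerProductSpace ℂ H] [CompleteSpace H]
    [TopologicalSpace.SeparableSpace H] (hH : ¬ FiniteDimensional ℂ H)
    (hA : IsAmenableGCStarAlgebra (redStableHigsonAction G H)) :
    AmenableGroup G := by
  obtain ⟨φ, hφ, hone, hinv⟩ := exists_invariant_state_redStableHigson (H := H) G hH
  exact hA.amenableGroup hφ hone hinv
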